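/- On the unit sphere, let a regular spherical triangle (vertices in general position, sides minor great-circle arcs, lying inside a hemisphere) have edge length $a$ and all angles equal to $\alpha$. Let a spherical rhombus (a simple quadrilateral all of whose sides are minor great-circle arcs of the same length $a$) have interior angles $\beta,\gamma,\beta,\gamma$ in cyclic order, with $\beta\ge\gamma$. Suppose that this protoset is convex, i.e. $\beta<\pi$, and rational, i.e. $\alpha,\beta,\gamma$ are rational multiples of $\pi$. Then one of the following holds: \begin{itemize} \item $(\alpha,\beta,\gamma)=\left(\frac49,\frac79,\frac23\right)\pi$; \item $(\alpha,\beta,\gamma)=\left(\frac37,\frac{17}{21},\frac{11}{21}\right)\pi$; \item $(\alpha,\beta,\gamma)=(\alpha,2\alpha,\alpha)$ with $\alpha\in\left(\mathbb{Q}\cap\left(\frac13,\frac12\right)\right)\pi$. \end{itemize} -/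

import Mathlib

namespace SphericalTiling

/-- Euclidean three-space. -/
abbrev E3 : Type := EuclideanSpace ℝ (Fin 3)

/-- The unit sphere in Euclidean three-space. -/
abbrev S2 : Type := Metric.sphere (0 : E3) 1

/-- The spherical (great-circle) distance, with values in `[0, π]`. -/
noncomputable def sDist (u v : S2) : ℝ :=
  InnerProductGeometry.angle (u : E3) (v : E3)

/-- The minor great-circle arc joining two non-antipodal points: the points that lie
between them for the spherical distance. -/
def arc (u v : S2) : Set S2 :=
  {w | sDist u w + sDist w v = sDist u v}

/-- The tangential component of `v` at `u`; for `v ≠ ±u` this is the initial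
direction, at `u`, of the minor arc from `u` to `v`. -/
noncomputable def tangentDir (u v : S2) : E3 :=
  (v : E3) - (inner ℝ (u : E3) (v : E3)) • (u : E3)

/-- The unoriented angle in `[0, π]`, at `v`, between the arcs from `v` to `u` and
from `v` to `w`. -/
noncomputable def arcAngle (u v w : S2) : ℝ :=
  InnerProductGeometry.angle (tangentDir v u) (tangentDir v w)

/-- The determinant of three points of the sphere. It is positive exactly when the path
`u → v → w` along minor arcs turns to the left at `v`, seen from outside the sphere. -/
def orient (u v w : S2) : ℝ :=
  Matrix.det !![(u : E3) 0, (u : E3) 1, (u : E3) 2;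
                (v : E3) 0, (v : E3) 1, (v : E3) 2;
                (w : E3) 0, (w : E3) 1, (w : E3) 2]

open Classical in
/-- The interior angle in `[0, 2π)`, at the vertex `v` with previous vertex `u` and next
vertex `w`, of a polygon whose boundary is traversed with its interior on the left. -/
noncomputable def interiorAngle (u v w : S2) : ℝ :=
  if 0 ≤ orient u v w then arcAngle u v w else 2 * Real.pi - arcAngle u v w

/-- `A, B, C` are the vertices, in counterclockwise order, of a (nondegenerate) regular
spherical triangle with edge length `a` and angle `α`. As usual, a spherical triangle lies
on the left of its positively oriented boundary of minor arcs, inside a hemisphere. -/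
structure IsRegularTriangle (a α : ℝ) (A B C : S2) : Prop where
  pos : 0 < orient A B C
  side_AB : sDist A B = a
  side_BC : sDist B C = a
  side_CA : sDist C A = a
  angle_A : interiorAngle C A B = α
  angle_B : interiorAngle A B C = α
  angle_C : interiorAngle B C A = α

/-- The closed path `P → Q → R → S → P` of minor arcs has no self-intersection. -/
structure IsSimpleQuad (P Q R S : S2) : Prop where
  meet_Q : arc P Q ∩ arc Q R = {Q}
  meet_R : arc Q R ∩ arc R S = {R}
  meet_S : arc R S ∩ arc S P = {S}
  meet_P : arc S P ∩ arc P Q = {P}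
  disj_PQ_RS : arc P Q ∩ arc R S = ∅
  disj_QR_SP : arc Q R ∩ arc S P = ∅

/-- `P, Q, R, S` are the vertices, in counterclockwise order, of a spherical rhombus
(a simple quadrilateral, not necessarily convex) with edge length `a` and with interior
angles `β, γ, β, γ`. -/
structure IsRhombus (a β γ : ℝ) (P Q R S : S2) : Prop where
  simple : IsSimpleQuad P Q R S
  side_pos : 0 < a
  side_PQ : sDist P Q = a
  side_QR : sDist Q R = a
  side_RS : sDist R S = a
  side_SP : sDist S P = a
  angle_P : interiorAngle S P Q = β
  angle_Q : interiorAngle P Q R = γ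
  angle_R : interiorAngle Q R S = β
  angle_S : interiorAngle R S P = γ

/-- A regular triangle with angle `α` and a rhombus with angles `β ≥ γ`, both with edge
length `a`, exist on the unit sphere; together they form a protoset of type `(a³, a⁴)`. -/
structure IsProtoset (a α β γ : ℝ) : Prop where
  triangle : ∃ A B C : S2, IsRegularTriangle a α A B C
  rhombus : ∃ P Q R S : S2, IsRhombus a β γ P Q R S
  le : γ ≤ β

/-- A protoset whose larger rhombus angle is `β` is convex when `β < π`. -/
def IsConvexAngle (β : ℝ) : Prop := β < Real.pi

/-- The angle is a rational multiple of `π`. -/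
def IsRationalAngle (θ : ℝ) : Prop := ∃ q : ℚ, θ = (q : ℝ) * Real.pi

end SphericalTiling

namespace SphericalTiling

open Polynomial Finset

/-! Spherical trigonometry reduces the problem to one equation. With `c = cos a`, the triangle gives
`cos α * (1 + c) = c`, and the rhombus gives `c = cot (β/2) * cot (γ/2)`. Eliminating `c` and
putting `x = (β - γ)/2`, `y = (β + γ)/2` yields `cos (α + x) + cos (α - x) = cos x + cos y`, with
`π/3 < α < π/2`, `0 ≤ x < π/2` and `π/2 < y < π`. The rational solutions are found in
`rational_angle_classification`.

Write the angles as multiples of `2π/N` with no prime factor of `N` common to all numerators. The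
equation is then a vanishing sum of eight `N`-th roots of unity. If `N` does not divide `420`,
Galois conjugation isolates the terms in one residue class of exponents (`exists_signs_of_not_dvd`).
That class contains at most one of each conjugate pair, so its real and imaginary parts give a
vanishing sum of at most four unit vectors. Such sums are rigid (`pairing_of_signed_subsum`),
leaving the family `(2x, x, 3x)` and one sporadic solution. If `N` divides `420`, the relation
survives reduction modulo a prime congruent to `1` modulo `420`. There a finite check
(`four_cos_of_denominator_420`) leaves the same family and the heptagonal solution. -/

/-! ### Vanishing sums of roots of unity and residue classes of exponents -/

theorem zpow_eq_pow_emod_toNat {F : Type*} [Field F] {N : ℕ} (hN : 0 < N) {η : F}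
    (hη : IsPrimitiveRoot η N) (e : ℤ) : η ^ e = η ^ (e % N).toNat := by
  have h0 : 0 ≤ e % (N : ℤ) := Int.emod_nonneg _ (by exact_mod_cast hN.ne')
  conv_lhs => rw [← Int.emod_add_mul_ediv e N]
  rw [zpow_add₀ (hη.ne_zero hN.ne'), zpow_mul, zpow_natCast, hη.pow_eq_one, one_zpow, mul_one,
    ← zpow_natCast, Int.toNat_of_nonneg h0]

/-- An integral linear relation between powers of a complex primitive `N`-th root of unity holds
for every primitive `N`-th root of unity of every field. -/
theorem relation_transfer {ι : Type*} [Fintype ι] {N : ℕ} (hN : 0 < N) {ζ : ℂ}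
    (hζ : IsPrimitiveRoot ζ N) {K : Type*} [Field K] {ξ : K} (hξ : IsPrimitiveRoot ξ N)
    (c E : ι → ℤ) (h : ∑ i, (c i : ℂ) * ζ ^ E i = 0) : ∑ i, (c i : K) * ξ ^ E i = 0 := by
  set f : ℤ[X] := ∑ i, C (c i) * X ^ (E i % N).toNat with hf
  have h1 : aeval ζ f = 0 := by
    rw [← h, hf, map_sum]
    refine Finset.sum_congr rfl fun i _ => ?_
    rw [zpow_eq_pow_emod_toNat hN hζ (E i)]
    simp
  -- Divisibility over `ℤ`, not merely over `ℚ`, is what lets the relation pass to positive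
  -- characteristic.
  have h2 : cyclotomic N ℤ ∣ f := by
    rw [cyclotomic_eq_minpoly hζ hN]
    exact minpoly.isIntegrallyClosed_dvd (hζ.isIntegral hN) h1
  have h3 : aeval ξ f = 0 := by
    obtain ⟨g, hg⟩ := h2
    have := hξ.isRoot_cyclotomic hN
    rw [hg, map_mul, aeval_def, eval₂_eq_eval_map, map_cyclotomic, (show eval ξ (cyclotomic N K) = 0 from this), zero_mul]
  rw [← h3, hf, map_sum]
  refine Finset.sum_congr rfl fun i _ => ?_
  rw [zpow_eq_pow_emod_toNat hN hξ (E i)]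
  simp

theorem sum_zpow_primitiveRoot {q : ℕ} {ω : ℂ} (hω : IsPrimitiveRoot ω q) (m : ℤ) :
    ∑ t ∈ range q, (ω ^ m) ^ t = if (q : ℤ) ∣ m then (q : ℂ) else 0 := by
  split_ifs with h
  · rw [(hω.zpow_eq_one_iff_dvd m).2 h]
    simp
  · have h1 : ω ^ m ≠ 1 := fun h' => h ((hω.zpow_eq_one_iff_dvd m).1 h')
    have h2 := mul_geom_sum (ω ^ m) q
    have h3 : (ω ^ m) ^ q = 1 := by
      rw [← zpow_natCast, ← zpow_mul, mul_comm, zpow_mul, zpow_natCast, hω.pow_eq_one, one_zpow]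
    rw [h3, sub_self] at h2
    exact (mul_eq_zero.1 h2).resolve_left (sub_ne_zero.2 h1)

/-- Fourier inversion: the part of a sum carried by a residue class modulo `q`. -/
theorem class_sum_inversion {ι : Type*} [Fintype ι] {q : ℕ} (hq : 0 < q) {ω : ℂ}
    (hω : IsPrimitiveRoot ω q) (z : ι → ℂ) (E : ι → ℤ) (s : ℤ) :
    ∑ t ∈ range q, (ω ^ (-s)) ^ t * ∑ i, z i * (ω ^ E i) ^ t
      = q * ∑ i, if (q : ℤ) ∣ E i - s then z i else 0 := by
  have hne : ω ≠ 0 := hω.ne_zero hq.ne'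
  simp_rw [Finset.mul_sum]
  rw [Finset.sum_comm]
  refine Finset.sum_congr rfl fun i _ => ?_
  have := sum_zpow_primitiveRoot hω (E i - s)
  calc ∑ t ∈ range q, (ω ^ (-s)) ^ t * (z i * (ω ^ E i) ^ t)
      = z i * ∑ t ∈ range q, (ω ^ (E i - s)) ^ t := by
        rw [Finset.mul_sum]
        refine Finset.sum_congr rfl fun t _ => ?_
        rw [sub_eq_add_neg, zpow_add₀ hne, mul_pow]
        ring
    _ = _ := by
        rw [this]
        split_ifs <;> ring

/-- The conjugation `ζ ↦ ζ ^ (1 + t * (N / q))` multiplies `ζ ^ e` by `ω ^ (t * e)` with `ω = ζ ^ (N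
/ q)`, a factor depending only on `e` modulo `q`. -/
theorem sum_twist_eq_zero {ι : Type*} [Fintype ι] {N q : ℕ} (hN : 0 < N) {ζ : ℂ}
    (hζ : IsPrimitiveRoot ζ N) (c E : ι → ℤ) (h : ∑ i, (c i : ℂ) * ζ ^ E i = 0) {t : ℕ}
    (ht : Nat.Coprime (1 + t * (N / q)) N) :
    ∑ i, ((c i : ℂ) * ζ ^ E i) * ((ζ ^ (N / q)) ^ E i) ^ t = 0 := by
  have hne : ζ ≠ 0 := hζ.ne_zero hN.ne'
  have := relation_transfer hN hζ (hζ.pow_of_coprime _ ht) c E h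
  rw [← this]
  refine Finset.sum_congr rfl fun i _ => ?_
  rw [← zpow_natCast, ← zpow_natCast, ← zpow_natCast, ← zpow_mul, ← zpow_mul, ← zpow_mul, mul_assoc,
    ← zpow_add₀ hne]
  congr 2
  push_cast
  ring

theorem class_sum_eq_zero_of_coprime {ι : Type*} [Fintype ι] {N q : ℕ} (hN : 0 < N) (hqN : q ∣ N)
    {ζ : ℂ} (hζ : IsPrimitiveRoot ζ N) (c E : ι → ℤ) (h : ∑ i, (c i : ℂ) * ζ ^ E i = 0)
    (hcop : ∀ t : ℕ, Nat.Coprime (1 + t * (N / q)) N) (s : ℤ) :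
    (∑ i, if (q : ℤ) ∣ E i - s then (c i : ℂ) * ζ ^ E i else 0) = 0 := by
  have hq : 0 < q := Nat.pos_of_dvd_of_pos hqN hN
  have hω : IsPrimitiveRoot (ζ ^ (N / q)) q := hζ.pow hN (Nat.div_mul_cancel hqN).symm
  have h1 := class_sum_inversion hq hω (fun i => (c i : ℂ) * ζ ^ E i) E s
  rw [Finset.sum_eq_zero] at h1
  · exact (mul_eq_zero.1 h1.symm).resolve_left (by exact_mod_cast hq.ne')
  · intro t _
    rw [sum_twist_eq_zero hN hζ c E h (hcop t), mul_zero]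

/-- Every prime factor of `N` divides `N / q`, so `1 + t * (N / q)` is always prime to `N`: all
twists vanish and Fourier inversion applies. -/
theorem class_sum_eq_zero_of_dvd_div {ι : Type*} [Fintype ι] {N q : ℕ} (hN : 0 < N) (hqN : q ∣ N)
    {ζ : ℂ} (hζ : IsPrimitiveRoot ζ N) (c E : ι → ℤ) (h : ∑ i, (c i : ℂ) * ζ ^ E i = 0)
    (hrad : ∀ p : ℕ, p.Prime → p ∣ q → p ∣ N / q) (s : ℤ) :
    (∑ i, if (q : ℤ) ∣ E i - s then (c i : ℂ) * ζ ^ E i else 0) = 0 := by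
  refine class_sum_eq_zero_of_coprime hN hqN hζ c E h (fun t => ?_) s
  refine Nat.coprime_of_dvd fun p hp h1 h2 => ?_
  have h3 : p ∣ N / q := by
    rw [← Nat.div_mul_cancel hqN, hp.dvd_mul] at h2
    exact h2.elim id (hrad p hp)
  exact hp.one_lt.ne' (Nat.dvd_one.1 ((Nat.dvd_add_left (h3.mul_left t)).1 h1))

/-- When `p` divides `N` exactly once, one twist modulo `p` is not a Galois conjugate. The empty
class `s₀` supplies the missing equation. -/
theorem class_sum_eq_zero_of_missed {ι : Type*} [Fintype ι] {N p : ℕ} (hN : 0 < N) (hp : p.Prime)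
    (hpN : p ∣ N) {ζ : ℂ} (hζ : IsPrimitiveRoot ζ N) (c E : ι → ℤ)
    (h : ∑ i, (c i : ℂ) * ζ ^ E i = 0) (s₀ : ℤ) (hs₀ : ∀ i, ¬ (p : ℤ) ∣ E i - s₀) (s : ℤ) :
    (∑ i, if (p : ℤ) ∣ E i - s then (c i : ℂ) * ζ ^ E i else 0) = 0 := by
  by_cases hpp : p ∣ N / p
  · refine class_sum_eq_zero_of_dvd_div hN hpN hζ c E h (fun r hr hrp => ?_) s
    rwa [(Nat.prime_dvd_prime_iff_eq hr hp).1 hrp]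
  have hω : IsPrimitiveRoot (ζ ^ (N / p)) p := hζ.pow hN (Nat.div_mul_cancel hpN).symm
  have hωne : ζ ^ (N / p) ≠ 0 := hω.ne_zero hp.ne_zero
  set M := N / p with hM
  have hNM : N = M * p := (Nat.div_mul_cancel hpN).symm
  have hMp : Nat.Coprime M p := ((Nat.Prime.coprime_iff_not_dvd hp).2 hpp).symm
  have hgood : ∀ t : ℕ, ¬ p ∣ 1 + t * M → Nat.Coprime (1 + t * M) N := by
    intro t ht
    rw [hNM]
    refine Nat.Coprime.mul_right ?_ ((Nat.Prime.coprime_iff_not_dvd hp).2 ht).symm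
    simp
  have huniq : ∀ t u : ℕ, t < p → u < p → p ∣ 1 + t * M → p ∣ 1 + u * M → t = u := by
    intro t u ht hu h1 h2
    have h3 : 1 + t * M ≡ 1 + u * M [MOD p] :=
      ((Nat.modEq_zero_iff_dvd).2 h1).trans ((Nat.modEq_zero_iff_dvd).2 h2).symm
    have h4 : t * M ≡ u * M [MOD p] := Nat.ModEq.add_left_cancel' 1 h3
    have h5 : t ≡ u [MOD p] := Nat.ModEq.cancel_right_of_coprime hMp.symm h4
    exact Nat.ModEq.eq_of_lt_of_lt h5 ht hu
  have hzero : ∀ t : ℕ, ¬ p ∣ 1 + t * M →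
      ∑ i, ((c i : ℂ) * ζ ^ E i) * ((ζ ^ M) ^ E i) ^ t = 0 :=
    fun t ht => sum_twist_eq_zero hN hζ c E h (hgood t ht)
  have hall : ∀ t ∈ range p, ∑ i, ((c i : ℂ) * ζ ^ E i) * ((ζ ^ M) ^ E i) ^ t = 0 := by
    intro t ht
    by_cases h1 : p ∣ 1 + t * M
    · have h2 := class_sum_inversion hp.pos hω (fun i => (c i : ℂ) * ζ ^ E i) E s₀
      -- Only the exceptional twist can survive in the inversion formula at `s₀`, whose right side
      -- is zero; hence it vanishes too.
      rw [Finset.sum_eq_single t] at h2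
      · rw [Finset.sum_eq_zero (fun i _ => if_neg (hs₀ i)), mul_zero] at h2
        exact (mul_eq_zero.1 h2).resolve_left (pow_ne_zero _ (zpow_ne_zero _ hωne))
      · intro u hu hut
        rw [hzero u (fun h3 => hut (huniq u t (mem_range.1 hu) (mem_range.1 ht) h3 h1)), mul_zero]
      · exact fun h3 => absurd ht h3
    · exact hzero t h1
  have h1 := class_sum_inversion hp.pos hω (fun i => (c i : ℂ) * ζ ^ E i) E s
  rw [Finset.sum_eq_zero] at h1
  · exact (mul_eq_zero.1 h1.symm).resolve_left (by exact_mod_cast hp.ne_zero)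
  · intro t ht
    rw [hall t ht, mul_zero]

theorem exists_missed_class {ι : Type*} [Fintype ι] {p : ℕ} (hcard : Fintype.card ι < p)
    (E : ι → ℤ) : ∃ s₀ : ℤ, ∀ i, ¬ (p : ℤ) ∣ E i - s₀ := by
  have hp : 0 < p := by omega
  have : NeZero p := ⟨hp.ne'⟩
  have : ¬ Function.Surjective fun i => (E i : ZMod p) := by
    intro hs
    have := Fintype.card_le_of_surjective _ hs
    rw [ZMod.card] at this
    omega
  simp only [Function.Surjective, not_forall, not_exists] at this
  obtain ⟨b, hb⟩ := this
  refine ⟨(b.val : ℤ), fun i hi => hb i ?_⟩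
  have := (ZMod.intCast_eq_intCast_iff_dvd_sub (b.val : ℤ) (E i) p).2 hi
  simpa using this.symm

/-! ### Signed subsums of a vanishing sum of four cosines -/

theorem exp_root_zpow (N : ℕ) (e : ℤ) : Complex.exp (2 * Real.pi * Complex.I / N) ^ e =
    ⟨Real.cos (2 * Real.pi * e / N), Real.sin (2 * Real.pi * e / N)⟩ := by
  rw [← Complex.exp_int_mul]
  have : (e : ℂ) * (2 * Real.pi * Complex.I / N)
      = ((2 * Real.pi * e / N : ℝ) : ℂ) * Complex.I := by
    push_cast; ring
  rw [this]
  apply Complex.ext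
  · rw [Complex.exp_ofReal_mul_I_re]
  · rw [Complex.exp_ofReal_mul_I_im]

theorem sum_intUnits {M : Type*} [AddCommMonoid M] (f : ℤˣ → M) : ∑ s, f s = f 1 + f (-1) := by
  rw [show (Finset.univ : Finset ℤˣ) = {1, -1} by rfl, Finset.sum_pair (by decide)]

/-- The part of a vanishing sum of cosines in the residue classes of `±E k` modulo `q`. -/
theorem exists_signs_of_class_sum {q N : ℕ} (c E : Fin 4 → ℤ) {k : Fin 4}
    (hk : ¬ (q : ℤ) ∣ 2 * E k)
    (h : (∑ i : Fin 4 × ℤˣ, if (q : ℤ) ∣ (i.2 : ℤ) * E i.1 - E k then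
      (c i.1 : ℂ) * Complex.exp (2 * Real.pi * Complex.I / N) ^ ((i.2 : ℤ) * E i.1) else 0) = 0) :
    ∃ δ : Fin 4 → ℤ, (∀ i, δ i = 0 ∨ δ i = 1 ∨ δ i = -1) ∧ δ k ≠ 0 ∧
      ∑ i, (δ i : ℝ) ^ 2 * (c i * Real.cos (2 * Real.pi * E i / N)) = 0 ∧
      ∑ i, (δ i : ℝ) * (c i * Real.sin (2 * Real.pi * E i / N)) = 0 := by
  -- The class of `E k` is not its own negative, so it never contains both `e` and `-e`.
  have hk' : ∀ e : ℤ, (q : ℤ) ∣ e - E k → ¬ (q : ℤ) ∣ -e - E k := by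
    intro e h1 h2
    apply hk
    have := dvd_add h1 h2
    rw [show e - E k + (-e - E k) = -(2 * E k) by ring] at this
    exact (dvd_neg.1 this)
  -- The sign records which of `E i`, `-E i` lies in the class. Cosine is even and sine odd, hence
  -- the weights `δ ^ 2` and `δ`.
  refine ⟨fun i => if (q : ℤ) ∣ E i - E k then 1 else if (q : ℤ) ∣ -E i - E k then -1 else 0,
    fun i => ?_, ?_, ?_⟩
  · dsimp only
    split_ifs <;> simp
  · simp
  rw [Fintype.sum_prod_type] at h
  simp only [sum_intUnits, Units.val_one, one_mul, Units.val_neg, neg_mul, exp_root_zpow] at h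
  have hre := congrArg Complex.re h
  have him := congrArg Complex.im h
  rw [Complex.re_sum, Complex.zero_re] at hre
  rw [Complex.im_sum, Complex.zero_im] at him
  constructor
  · rw [← hre]
    refine Finset.sum_congr rfl fun i _ => ?_
    by_cases h1 : (q : ℤ) ∣ E i - E k
    · simp [h1, hk' _ h1]
    · by_cases h2 : (q : ℤ) ∣ -E i - E k
      · simp [h1, h2, neg_div]
      · simp [h1, h2]
  · rw [← him]
    refine Finset.sum_congr rfl fun i _ => ?_
    by_cases h1 : (q : ℤ) ∣ E i - E k
    · simp [h1, hk' _ h1]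
    · by_cases h2 : (q : ℤ) ∣ -E i - E k
      · simp [h1, h2, neg_div]
      · simp [h1, h2]

theorem sum_root_zpow_eq_zero_of_sum_cos {N : ℕ} (c E : Fin 4 → ℤ)
    (h : ∑ i, (c i : ℝ) * Real.cos (2 * Real.pi * E i / N) = 0) :
    ∑ i : Fin 4 × ℤˣ, (c i.1 : ℂ) *
      Complex.exp (2 * Real.pi * Complex.I / N) ^ ((i.2 : ℤ) * E i.1) = 0 := by
  rw [Fintype.sum_prod_type]
  simp only [sum_intUnits, Units.val_one, one_mul, Units.val_neg, neg_mul, exp_root_zpow]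
  apply Complex.ext
  · rw [Complex.re_sum, Complex.zero_re]
    calc _ = 2 * ∑ i, (c i : ℝ) * Real.cos (2 * Real.pi * E i / N) := by
          rw [Finset.mul_sum]
          refine Finset.sum_congr rfl fun i _ => ?_
          simp [neg_div]
          ring
      _ = 0 := by rw [h, mul_zero]
  · rw [Complex.im_sum, Complex.zero_im]
    refine Finset.sum_eq_zero fun i _ => ?_
    simp [neg_div]

/-- Since `420 = 4 * 3 * 5 * 7`, a non-divisor has a prime factor beyond `7` or too high a power of
a smaller prime. -/
theorem exists_large_prime_factor_of_not_dvd {N : ℕ} (hN : ¬ N ∣ 420) :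
    (∃ p, p.Prime ∧ p ∣ N ∧ 11 ≤ p) ∨ (∃ p, p.Prime ∧ p ≠ 2 ∧ p * p ∣ N) ∨ 8 ∣ N := by
  by_contra! hcon
  obtain ⟨h1, h2, h3⟩ := hcon
  apply hN
  rw [Nat.dvd_iff_prime_pow_dvd_dvd]
  intro p k hp hk
  rcases Nat.eq_zero_or_pos k with rfl | hk0
  · simp
  have hpN : p ∣ N := (dvd_pow_self p hk0.ne').trans hk
  have hp11 := h1 p hp hpN
  by_cases hp2 : p = 2
  · subst hp2
    have : k < 3 := by
      by_contra! h4
      exact h3 ((pow_dvd_pow 2 h4).trans hk)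
    interval_cases k <;> norm_num
  · have hk1 : k = 1 := by
      by_contra h4
      refine h2 p hp hp2 (Dvd.dvd.trans ?_ hk)
      rw [← sq]
      exact pow_dvd_pow p (by omega)
    subst hk1
    have := hp.two_le
    interval_cases p <;> first | omega | (exfalso; revert hp; norm_num)

/-- If the common denominator does not divide `420`, a four-term vanishing sum of signed cosines
has a proper or improper subsum for which the sines, with suitable signs, also sum to zero. -/
theorem exists_signs_of_not_dvd {N : ℕ} (hN0 : 0 < N) (hN : ¬ N ∣ 420) (c E : Fin 4 → ℤ)
    (hE : ∀ p : ℕ, p.Prime → p ∣ N → ∃ k, ¬ (p : ℤ) ∣ E k)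
    (h : ∑ i, (c i : ℝ) * Real.cos (2 * Real.pi * E i / N) = 0) :
    ∃ δ : Fin 4 → ℤ, (∀ i, δ i = 0 ∨ δ i = 1 ∨ δ i = -1) ∧ (∃ k, δ k ≠ 0) ∧
      ∑ i, (δ i : ℝ) ^ 2 * (c i * Real.cos (2 * Real.pi * E i / N)) = 0 ∧
      ∑ i, (δ i : ℝ) * (c i * Real.sin (2 * Real.pi * E i / N)) = 0 := by
  have hζ := Complex.isPrimitiveRoot_exp N hN0.ne'
  have hsum := sum_root_zpow_eq_zero_of_sum_cos c E h
  have hodd : ∀ p : ℕ, p.Prime → p ≠ 2 → ∀ e : ℤ, ¬ (p : ℤ) ∣ e → ¬ (p : ℤ) ∣ 2 * e := by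
    intro p hp hp2 e he h2
    rcases (Nat.prime_iff_prime_int.1 hp).dvd_or_dvd h2 with h3 | h3
    · exact hp2 ((Nat.prime_dvd_prime_iff_eq hp Nat.prime_two).1 (by exact_mod_cast h3))
    · exact he h3
  rcases exists_large_prime_factor_of_not_dvd hN with ⟨p, hp, hpN, h11⟩ | ⟨p, hp, hp2, hpN⟩ | h8
  · obtain ⟨k, hk⟩ := hE p hp hpN
    -- The eight exponents `±E i` cannot meet all `p ≥ 11` residue classes.
    have hcard : Fintype.card (Fin 4 × ℤˣ) < p := by
      have : Fintype.card (Fin 4 × ℤˣ) = 8 := by decide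
      omega
    obtain ⟨s₀, hs₀⟩ := exists_missed_class hcard (fun i : Fin 4 × ℤˣ => (i.2 : ℤ) * E i.1)
    obtain ⟨δ, h1, h2, h3⟩ := exists_signs_of_class_sum c E (hodd p hp (by omega) _ hk)
      (class_sum_eq_zero_of_missed hN0 hp hpN hζ (fun i : Fin 4 × ℤˣ => c i.1)
        (fun i => (i.2 : ℤ) * E i.1) hsum s₀ hs₀ (E k))
    exact ⟨δ, h1, ⟨k, h2⟩, h3⟩
  · have hpN' : p ∣ N := (dvd_mul_right p p).trans hpN
    obtain ⟨k, hk⟩ := hE p hp hpN'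
    obtain ⟨δ, h1, h2, h3⟩ := exists_signs_of_class_sum c E (hodd p hp hp2 _ hk)
      (class_sum_eq_zero_of_dvd_div hN0 hpN' hζ (fun i : Fin 4 × ℤˣ => c i.1)
        (fun i => (i.2 : ℤ) * E i.1) hsum (fun r hr hrp => by
          rw [(Nat.prime_dvd_prime_iff_eq hr hp).1 hrp]
          exact Nat.dvd_div_of_mul_dvd hpN) (E k))
    exact ⟨δ, h1, ⟨k, h2⟩, h3⟩
  · have h4 : 4 ∣ N := (by norm_num : 4 ∣ 8).trans h8
    obtain ⟨k, hk⟩ := hE 2 Nat.prime_two ((by norm_num : 2 ∣ 8).trans h8)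
    -- Modulo `2` every class is its own negative, so `q = 4` is used: `E k` is odd, and `N / 4` is
    -- still even.
    obtain ⟨δ, h1, h2, h3⟩ := exists_signs_of_class_sum (q := 4) c E (k := k) (by push_cast at hk ⊢; omega)
      (class_sum_eq_zero_of_dvd_div hN0 h4 hζ (fun i : Fin 4 × ℤˣ => c i.1)
        (fun i => (i.2 : ℤ) * E i.1) hsum (fun r hr hrp => by
          have h2 : r ∣ 2 := hr.dvd_of_dvd_pow (show r ∣ 2 ^ 2 from hrp)
          rw [(Nat.prime_dvd_prime_iff_eq hr Nat.prime_two).1 h2]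
          exact Nat.dvd_div_of_mul_dvd h8) (E k))
    exact ⟨δ, h1, ⟨k, h2⟩, h3⟩

/-! ### Denominators dividing 420: a finite check modulo a prime -/

/-- The Dickson polynomial of degree `420`, which maps `y + y⁻¹` to `y ^ 420 + y⁻¹ ^ 420`, on
residues modulo `127261`, written as a composition along `420 = 2 * 2 * 3 * 5 * 7`. -/
def dicksonResidue (w : ℕ) : ℕ :=
  -- Negative coefficients are represented by their residues, as in `127259` for `-2`, to avoid
  -- truncated subtraction.
  let w₂ := (w * w + 127259) % 127261
  let w₄ := (w₂ * w₂ + 127259) % 127261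
  let w₁₂ := (w₄ ^ 3 + 127258 * w₄) % 127261
  let w₆₀ := (w₁₂ ^ 5 + 127256 * w₁₂ ^ 3 + 5 * w₁₂) % 127261
  (w₆₀ ^ 7 + 127254 * w₆₀ ^ 5 + 14 * w₆₀ ^ 3 + 127254 * w₆₀) % 127261

/-- The residue of `2 * cos (2 * π * k / 420)` modulo a prime over `127261`. -/
def cosResidue (k : ℕ) : ℕ := (20347 ^ k + 20347 ^ (420 - k)) % 127261

/-- The equation reads `2 cos y = (2 cos α - 1) * (2 cos x)`. If `y` has denominator `420`, the
right side is `η + η⁻¹` with `η ^ 420 = 1`, so the Dickson polynomial takes the value `2` there.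
This eliminates `y`; the bounds encode `70 < A < 105` and `0 ≤ X < 105`. -/
theorem dicksonResidue_ne_two : ∀ A < 34, ∀ X < 105,
    dicksonResidue ((cosResidue (A + 71) + 127260) * cosResidue X) = 2 →
      (A + 71 = 2 * X ∨ (A + 71 = 90 ∧ X = 30)) := by
  decide +kernel

theorem dicksonResidue_cast (w : ℕ) {y y' : ZMod 127261} (hy : y * y' = 1)
    (hw : (w : ZMod 127261) = y + y') :
    (dicksonResidue w : ZMod 127261) = y ^ 420 + y' ^ 420 := by
  have hc2 : ((127259 : ℕ) : ZMod 127261) = -2 := by decide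
  have hc3 : ((127258 : ℕ) : ZMod 127261) = -3 := by decide
  have hc5 : ((127256 : ℕ) : ZMod 127261) = -5 := by decide
  have hc7 : ((127254 : ℕ) : ZMod 127261) = -7 := by decide
  have d2 : ∀ u u' : ZMod 127261, u * u' = 1 → (u + u') * (u + u') + -2 = u ^ 2 + u' ^ 2 := by
    intro u u' h
    linear_combination 2 * h
  have d3 : ∀ u u' : ZMod 127261, u * u' = 1 →
      (u + u') ^ 3 + -3 * (u + u') = u ^ 3 + u' ^ 3 := by
    intro u u' h
    linear_combination 3 * (u + u') * h
  have d5 : ∀ u u' : ZMod 127261, u * u' = 1 →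
      (u + u') ^ 5 + -5 * (u + u') ^ 3 + 5 * (u + u') = u ^ 5 + u' ^ 5 := by
    intro u u' h
    linear_combination (5 * (u + u') ^ 3 - 5 * (u + u') * (u * u' + 1)) * h
  have d7 : ∀ u u' : ZMod 127261, u * u' = 1 →
      (u + u') ^ 7 + -7 * (u + u') ^ 5 + 14 * (u + u') ^ 3 + -7 * (u + u') = u ^ 7 + u' ^ 7 := by
    intro u u' h
    linear_combination (7 * (u + u') ^ 5 - 14 * (u + u') ^ 3 * (u * u' + 1)
      + 7 * (u + u') * ((u * u') ^ 2 + u * u' + 1)) * h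
  have hpow : ∀ (u u' : ZMod 127261) (k : ℕ), u * u' = 1 → u ^ k * u' ^ k = 1 := by
    intro u u' k h
    rw [← mul_pow, h, one_pow]
  simp only [dicksonResidue, ZMod.natCast_mod, Nat.cast_add, Nat.cast_mul, Nat.cast_pow, hw, hc2,
    hc3, hc5, hc7, Nat.cast_ofNat]
  rw [d2 _ _ hy, d2 _ _ (hpow _ _ 2 hy), d3 _ _ (hpow _ _ 2 (hpow _ _ 2 hy)),
    d5 _ _ (hpow _ _ 3 (hpow _ _ 2 (hpow _ _ 2 hy))),
    d7 _ _ (hpow _ _ 5 (hpow _ _ 3 (hpow _ _ 2 (hpow _ _ 2 hy))))]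
  simp only [← pow_mul]

/-- The prime satisfies `127261 = 303 * 420 + 1`, so its residue field contains primitive `420`-th
roots of unity. -/
theorem isPrimitiveRoot_20347 : IsPrimitiveRoot (20347 : ZMod 127261) 420 := by
  have hcast : ∀ k : ℕ, (20347 : ZMod 127261) ^ k = 1 ↔ 20347 ^ k % 127261 = 1 := by
    intro k
    have := ZMod.natCast_eq_natCast_iff' (20347 ^ k) 1 127261
    push_cast at this
    exact this
  rw [IsPrimitiveRoot.iff_orderOf]
  refine orderOf_eq_of_pow_and_pow_div_prime (by norm_num) ((hcast _).2 (by decide +kernel)) ?_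
  intro p hp hdvd
  rw [Ne, hcast]
  have h : p = 2 ∨ p = 2 ∨ p = 3 ∨ p = 5 ∨ p = 7 := by
    rw [show 420 = 2 * (2 * (3 * (5 * 7))) by norm_num, hp.dvd_mul, hp.dvd_mul, hp.dvd_mul,
      hp.dvd_mul] at hdvd
    simpa only [Nat.prime_dvd_prime_iff_eq hp Nat.prime_two,
      Nat.prime_dvd_prime_iff_eq hp Nat.prime_three, Nat.prime_dvd_prime_iff_eq hp Nat.prime_five,
      Nat.prime_dvd_prime_iff_eq hp (show Nat.Prime 7 by norm_num)] using hdvd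
  rcases h with rfl | rfl | rfl | rfl | rfl <;> decide +kernel

instance : Fact (Nat.Prime 127261) := ⟨by norm_num⟩

theorem cosResidue_cast {k : ℕ} (hk : k ≤ 420) :
    (cosResidue k : ZMod 127261) = 20347 ^ (k : ℤ) + 20347 ^ (-(k : ℤ)) := by
  have hξ := isPrimitiveRoot_20347
  have hne : (20347 : ZMod 127261) ≠ 0 := hξ.ne_zero (by norm_num)
  have h1 : (20347 : ZMod 127261) ^ (420 - k) = 20347 ^ (-(k : ℤ)) := by
    rw [← zpow_natCast, Nat.cast_sub hk, sub_eq_add_neg, zpow_add₀ hne, zpow_natCast, hξ.pow_eq_one,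
      one_mul]
  rw [cosResidue, ZMod.natCast_mod, Nat.cast_add, Nat.cast_pow, Nat.cast_pow, Nat.cast_ofNat, h1,
    zpow_natCast]

theorem four_cos_of_denominator_420 {A X Y : ℤ} (hA : 70 < A) (hA' : A < 105) (hX : 0 ≤ X)
    (hX' : X < 105)
    (h : ∑ i, ((![1, 1, -1, -1] : Fin 4 → ℤ) i : ℝ) *
      Real.cos (2 * Real.pi * (![A + X, A - X, X, Y] : Fin 4 → ℤ) i / (420 : ℕ)) = 0) :
    A = 2 * X ∨ (A = 90 ∧ X = 30) := by
  have hξ := isPrimitiveRoot_20347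
  have hne : (20347 : ZMod 127261) ≠ 0 := hξ.ne_zero (by norm_num)
  have hc : ((127260 : ℕ) : ZMod 127261) = -1 := by decide
  have h1 := relation_transfer (by norm_num) (Complex.isPrimitiveRoot_exp 420 (by norm_num)) hξ
    (fun i : Fin 4 × ℤˣ => (![1, 1, -1, -1] : Fin 4 → ℤ) i.1)
    (fun i => (i.2 : ℤ) * (![A + X, A - X, X, Y] : Fin 4 → ℤ) i.1)
    (sum_root_zpow_eq_zero_of_sum_cos _ _ h)
  rw [Fintype.sum_prod_type, Fin.sum_univ_four] at h1
  simp only [sum_intUnits] at h1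
  simp [zpow_add₀ hne, zpow_sub₀ hne] at h1
  obtain ⟨n, hn⟩ := Int.eq_ofNat_of_zero_le (show 0 ≤ A - 71 by omega)
  obtain ⟨m, rfl⟩ := Int.eq_ofNat_of_zero_le hX
  obtain rfl : A = ((n + 71 : ℕ) : ℤ) := by push_cast; omega
  have h2 : (20347 : ZMod 127261) ^ Y * (20347 ^ Y)⁻¹ = 1 := mul_inv_cancel₀ (zpow_ne_zero _ hne)
  have h3 := dicksonResidue_cast ((cosResidue (n + 71) + 127260) * cosResidue m) h2 (by
    rw [Nat.cast_mul, Nat.cast_add, hc, cosResidue_cast (by omega), cosResidue_cast (by omega)]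
    rw [zpow_neg, zpow_neg]
    have hx0 : (20347 : ZMod 127261) ^ (m : ℤ) ≠ 0 := zpow_ne_zero _ hne
    have ha0 : (20347 : ZMod 127261) ^ ((n + 71 : ℕ) : ℤ) ≠ 0 := zpow_ne_zero _ hne
    rw [← sub_eq_zero, ← h1]
    ring)
  have h4 : (20347 ^ Y : ZMod 127261) ^ 420 = 1 := by
    rw [← zpow_natCast, ← zpow_mul, mul_comm, zpow_mul, zpow_natCast, hξ.pow_eq_one, one_zpow]
  rw [inv_pow, h4, inv_one] at h3
  have h5 : dicksonResidue ((cosResidue (n + 71) + 127260) * cosResidue m) = 2 := by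
    have h6 : ((dicksonResidue ((cosResidue (n + 71) + 127260) * cosResidue m) : ℕ) : ZMod 127261)
        = (2 : ℕ) := by rw [h3]; norm_num
    rw [ZMod.natCast_eq_natCast_iff'] at h6
    rwa [Nat.mod_eq_of_lt (show dicksonResidue _ < 127261 from Nat.mod_lt _ (by norm_num))] at h6
  rcases dicksonResidue_ne_two n (by omega) m (by omega) h5 with h6 | h6
  · left; omega
  · right; omega

/-! ### Short vanishing sums of unit vectors -/

/-- Conjugates are inverses, so the first and third elementary symmetric functions both vanish, and
`(z₁ + z₂)(z₁ + z₃)(z₁ + z₄) = z₁² e₁ + e₃`. -/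
theorem pairing_of_four_unit_sum {z₁ z₂ z₃ z₄ : ℂ} (h₁ : z₁ * starRingEnd ℂ z₁ = 1)
    (h₂ : z₂ * starRingEnd ℂ z₂ = 1) (h₃ : z₃ * starRingEnd ℂ z₃ = 1)
    (h₄ : z₄ * starRingEnd ℂ z₄ = 1) (h : z₁ + z₂ + z₃ + z₄ = 0) :
    z₁ + z₂ = 0 ∨ z₁ + z₃ = 0 ∨ z₁ + z₄ = 0 := by
  have hc : starRingEnd ℂ z₁ + starRingEnd ℂ z₂ + starRingEnd ℂ z₃ + starRingEnd ℂ z₄ = 0 := by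
    rw [← map_add, ← map_add, ← map_add, h, map_zero]
  have he : z₂ * z₃ * z₄ + z₁ * z₃ * z₄ + z₁ * z₂ * z₄ + z₁ * z₂ * z₃ = 0 := by
    linear_combination (z₁ * z₂ * z₃ * z₄) * hc - z₂ * z₃ * z₄ * h₁ - z₁ * z₃ * z₄ * h₂
      - z₁ * z₂ * z₄ * h₃ - z₁ * z₂ * z₃ * h₄
  have hprod : (z₁ + z₂) * ((z₁ + z₃) * (z₁ + z₄)) = 0 := by
    linear_combination z₁ ^ 2 * h + he
  rcases mul_eq_zero.1 hprod with h5 | h5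
  · exact Or.inl h5
  · exact Or.inr (mul_eq_zero.1 h5)

/-- The signs of `u₂`, `u₃`, `u₄` and the full relation rule out most supports of `d`. Two-term
supports give the pairings, and the full support reduces to `pairing_of_four_unit_sum`. In the
support `{2, 3, 4}` a difference of two unit vectors is a unit vector, so their inner product is `1
/ 2`. -/
theorem pairing_of_signed_subsum {u₁ u₂ u₃ u₄ v₁ v₂ v₃ v₄ : ℝ} (h₁ : u₁ ^ 2 + v₁ ^ 2 = 1)
    (h₂ : u₂ ^ 2 + v₂ ^ 2 = 1) (h₃ : u₃ ^ 2 + v₃ ^ 2 = 1) (h₄ : u₄ ^ 2 + v₄ ^ 2 = 1)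
    (p₂ : 0 < u₂) (p₃ : 0 < u₃) (p₄ : u₄ < 0) (h : u₁ + u₂ - u₃ - u₄ = 0) {d₁ d₂ d₃ d₄ : ℝ}
    (hd₁ : d₁ = 0 ∨ d₁ ^ 2 = 1) (hd₂ : d₂ = 0 ∨ d₂ ^ 2 = 1) (hd₃ : d₃ = 0 ∨ d₃ ^ 2 = 1)
    (hd₄ : d₄ = 0 ∨ d₄ ^ 2 = 1) (hd : ¬ (d₁ = 0 ∧ d₂ = 0 ∧ d₃ = 0 ∧ d₄ = 0))
    (hu : d₁ ^ 2 * u₁ + d₂ ^ 2 * u₂ - d₃ ^ 2 * u₃ - d₄ ^ 2 * u₄ = 0)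
    (hv : d₁ * v₁ + d₂ * v₂ - d₃ * v₃ - d₄ * v₄ = 0) :
    u₁ + u₂ = 0 ∨ (u₁ = u₄ ∧ u₂ = u₃) ∨
      (u₁ = 0 ∧ ∃ s : ℝ, (s = 1 ∨ s = -1) ∧ u₂ * u₃ + s * (v₂ * v₃) = 1 / 2) := by
  rcases hd₁ with rfl | e₁ <;> rcases hd₂ with rfl | e₂ <;> rcases hd₃ with rfl | e₃ <;>
    rcases hd₄ with rfl | e₄
  · simp at hd
  · rw [e₄] at hu; linarith
  · rw [e₃] at hu; linarith
  · rw [e₃, e₄] at hu; left; linarith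
  · rw [e₂] at hu; linarith
  · rw [e₂, e₄] at hu; linarith
  · rw [e₂, e₃] at hu; right; left; constructor <;> linarith
  · rw [e₂, e₃, e₄] at hu
    refine Or.inr (Or.inr ⟨by linarith, d₂ * d₃, sq_eq_one_iff.1 (by rw [mul_pow, e₂, e₃, one_mul]), ?_⟩)
    have h5 : u₄ = u₂ - u₃ := by linarith
    have h6 : d₄ * v₄ = d₂ * v₂ - d₃ * v₃ := by linarith
    have h7 : u₄ ^ 2 + (d₄ * v₄) ^ 2 = 1 := by rw [mul_pow, e₄, one_mul, h₄]
    rw [h5, h6] at h7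
    linear_combination (-1 / 2) * h7 + (1 / 2) * h₂ + (1 / 2) * h₃ + (1 / 2) * v₂ ^ 2 * e₂
      + (1 / 2) * v₃ ^ 2 * e₃
  · have h5 : u₁ = 0 := by rw [e₁] at hu; linarith
    have h6 : d₁ * v₁ = 0 := by linarith
    have h7 : u₁ ^ 2 + (d₁ * v₁) ^ 2 = 1 := by rw [mul_pow, e₁, one_mul, h₁]
    rw [h5, h6] at h7
    norm_num at h7
  · rw [e₁, e₄] at hu; right; left; constructor <;> linarith
  · rw [e₁, e₃] at hu; linarith
  · rw [e₁, e₃, e₄] at hu; linarith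
  · rw [e₁, e₂] at hu; left; linarith
  · rw [e₁, e₂, e₄] at hu; linarith
  · rw [e₁, e₂, e₃] at hu; linarith
  · have hz : ∀ {u v d : ℝ}, u ^ 2 + v ^ 2 = 1 → d ^ 2 = 1 →
        (⟨u, d * v⟩ : ℂ) * starRingEnd ℂ ⟨u, d * v⟩ = 1 := by
      intro u v d h5 h6
      rw [Complex.mul_conj, Complex.normSq_mk, Complex.ofReal_eq_one]
      linear_combination h5 + v ^ 2 * h6
    have hz' : ∀ {u v d : ℝ}, u ^ 2 + v ^ 2 = 1 → d ^ 2 = 1 →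
        (-⟨u, d * v⟩ : ℂ) * starRingEnd ℂ (-⟨u, d * v⟩) = 1 := by
      intro u v d h5 h6
      rw [map_neg, neg_mul_neg, hz h5 h6]
    rcases pairing_of_four_unit_sum (hz h₁ e₁) (hz h₂ e₂) (hz' h₃ e₃) (hz' h₄ e₄)
      (by apply Complex.ext <;> simp <;> linarith) with h5 | h5 | h5
    · left
      simpa using congrArg Complex.re h5
    · have : u₁ + -u₃ = 0 := by simpa using congrArg Complex.re h5
      linarith
    · have : u₁ + -u₄ = 0 := by simpa using congrArg Complex.re h5
      right; left; constructor <;> linarith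

/-- The case analysis of four-term cosine relations with a signed vanishing subsum. -/
theorem angles_of_signed_subsum {α x y : ℝ} (hα : Real.pi / 3 < α) (hα' : α < Real.pi / 2)
    (hx : 0 ≤ x) (hx' : x < Real.pi / 2) (hy : Real.pi / 2 < y) (hy' : y < Real.pi)
    (h : Real.cos (α + x) + Real.cos (α - x) - Real.cos x - Real.cos y = 0)
    {d₁ d₂ d₃ d₄ : ℝ}
    (hd₁ : d₁ = 0 ∨ d₁ ^ 2 = 1) (hd₂ : d₂ = 0 ∨ d₂ ^ 2 = 1) (hd₃ : d₃ = 0 ∨ d₃ ^ 2 = 1)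
    (hd₄ : d₄ = 0 ∨ d₄ ^ 2 = 1) (hd : ¬ (d₁ = 0 ∧ d₂ = 0 ∧ d₃ = 0 ∧ d₄ = 0))
    (hu : d₁ ^ 2 * Real.cos (α + x) + d₂ ^ 2 * Real.cos (α - x) - d₃ ^ 2 * Real.cos x
      - d₄ ^ 2 * Real.cos y = 0)
    (hv : d₁ * Real.sin (α + x) + d₂ * Real.sin (α - x) - d₃ * Real.sin x
      - d₄ * Real.sin y = 0) :
    (α = 4 / 9 * Real.pi ∧ x = 1 / 18 * Real.pi ∧ y = 13 / 18 * Real.pi) ∨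
      (α = 2 * x ∧ y = 3 * x) := by
  have hpi := Real.pi_pos
  have p₂ : 0 < Real.cos (α - x) := Real.cos_pos_of_mem_Ioo ⟨by linarith, by linarith⟩
  have p₃ : 0 < Real.cos x := Real.cos_pos_of_mem_Ioo ⟨by linarith, by linarith⟩
  have p₄ : Real.cos y < 0 := Real.cos_neg_of_pi_div_two_lt_of_lt hy (by linarith)
  rcases pairing_of_signed_subsum (Real.cos_sq_add_sin_sq _) (Real.cos_sq_add_sin_sq _)
    (Real.cos_sq_add_sin_sq _) (Real.cos_sq_add_sin_sq _) p₂ p₃ p₄ h hd₁ hd₂ hd₃ hd₄ hd hu hv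
    with h1 | ⟨h1, h2⟩ | ⟨h1, s, hs, h2⟩
  · exfalso
    have h2 : 2 * Real.cos α * Real.cos x = 0 := by
      rw [← h1, Real.cos_add, Real.cos_sub]; ring
    have h3 : 0 < Real.cos α := Real.cos_pos_of_mem_Ioo ⟨by linarith, by linarith⟩
    exact absurd h2 (by positivity)
  · right
    have h3 : α + x = y := Real.injOn_cos ⟨by linarith, by linarith⟩ ⟨by linarith, by linarith⟩ h1
    have h4 : |α - x| = x := by
      rw [← Real.cos_abs (α - x)] at h2
      refine Real.injOn_cos ⟨abs_nonneg _, ?_⟩ ⟨hx, by linarith⟩ h2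
      rw [abs_le]
      constructor <;> linarith
    rcases abs_eq hx |>.1 h4 with h5 | h5
    · constructor <;> linarith
    · linarith
  · left
    have h3 : α + x = Real.pi / 2 :=
      Real.injOn_cos ⟨by linarith, by linarith⟩ ⟨by linarith, by linarith⟩
        (by rw [h1, Real.cos_pi_div_two])
    rcases hs with rfl | rfl
    · have h4 : Real.cos |α - x - x| = Real.cos (Real.pi / 3) := by
        rw [Real.cos_abs, Real.cos_sub, Real.cos_pi_div_three]; linarith
      have h5 : |α - x - x| = Real.pi / 3 := by
        refine Real.injOn_cos ⟨abs_nonneg _, ?_⟩ ⟨by linarith, by linarith⟩ h4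
        rw [abs_le]
        constructor <;> linarith
      have hx1 : x = 1 / 18 * Real.pi := by
        -- The other sign would give `x = 5π/18`, hence `α = 2π/9 < π/3`.
        rcases abs_eq (by linarith) |>.1 h5 with h6 | h6 <;> linarith
      refine ⟨by linarith, hx1, ?_⟩
      refine Real.injOn_cos ⟨by linarith, by linarith⟩ ⟨by linarith, by linarith⟩ ?_
      have h7 : Real.cos (α - x) - Real.cos x - Real.cos y = 0 := by linarith
      have h8 : Real.cos (13 / 18 * Real.pi) = Real.cos (α - x) - Real.cos x := by
        have h9 := Real.cos_sub_cos (α - x) x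
        rw [show (α - x - x) / 2 = Real.pi / 6 by linarith,
          show (α - x + x) / 2 = 13 / 18 * Real.pi - Real.pi / 2 by linarith,
          Real.sin_sub_pi_div_two, Real.sin_pi_div_six] at h9
        rw [h9]
        ring
      linarith
    · have h4 : Real.cos α = Real.cos (Real.pi / 3) := by
        rw [show α = (α - x) + x by ring, Real.cos_add, Real.cos_pi_div_three]; linarith
      have h5 : α = Real.pi / 3 :=
        Real.injOn_cos ⟨by linarith, by linarith⟩ ⟨by linarith, by linarith⟩ h4
      linarith

/-! ### Rational solutions of the cosine equation -/

/-- Multiplication by `2 * sin (π/7)` makes the sum telescope. The identity determines `y` in the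
heptagonal solution. -/
theorem cos_heptagon :
    Real.cos (4 / 7 * Real.pi) + Real.cos (2 / 7 * Real.pi) - Real.cos (1 / 7 * Real.pi) = -1 / 2 := by
  have hpi := Real.pi_pos
  have hs : 0 < Real.sin (1 / 7 * Real.pi) :=
    Real.sin_pos_of_pos_of_lt_pi (by positivity) (by linarith)
  set t := 1 / 7 * Real.pi with ht
  have e3 : Real.sin (4 * t) = Real.sin (3 * t) := by
    rw [← Real.sin_pi_sub]; congr 1; rw [ht]; ring
  have e5 : Real.sin (5 * t) = Real.sin (2 * t) := by
    rw [← Real.sin_pi_sub]; congr 1; rw [ht]; ring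
  have f1 : 2 * (Real.sin t * Real.cos (4 * t)) = Real.sin (5 * t) - Real.sin (3 * t) := by
    rw [show 5 * t = 4 * t + t by ring, show 3 * t = 4 * t - t by ring, Real.sin_add, Real.sin_sub]
    ring
  have f2 : 2 * (Real.sin t * Real.cos (2 * t)) = Real.sin (3 * t) - Real.sin t := by
    nth_rewrite 4 [show t = 2 * t - t by ring]
    rw [show 3 * t = 2 * t + t by ring, Real.sin_add, Real.sin_sub]
    ring
  have f3 : 2 * (Real.sin t * Real.cos t) = Real.sin (2 * t) := by
    rw [Real.sin_two_mul]; ring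
  rw [show 4 / 7 * Real.pi = 4 * t by rw [ht]; ring, show 2 / 7 * Real.pi = 2 * t by rw [ht]; ring]
  have h : Real.sin t * (Real.cos (4 * t) + Real.cos (2 * t) - Real.cos t + 1 / 2) = 0 := by
    linear_combination (1 / 2) * f1 + (1 / 2) * f2 - (1 / 2) * f3 + (1 / 2) * e5
  have := (mul_eq_zero.1 h).resolve_left hs.ne'
  linarith

/-- Rational angles have numerators over a common denominator without a common prime factor. -/
theorem exists_reduced_common_denominator {α x y : ℝ} (hα : IsRationalAngle α)
    (hx : IsRationalAngle x) (hy : IsRationalAngle y) :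
    ∃ (N : ℕ) (A X Y : ℤ), 0 < N ∧ α = 2 * Real.pi * A / N ∧ x = 2 * Real.pi * X / N ∧
      y = 2 * Real.pi * Y / N ∧
      ∀ p : ℕ, p.Prime → p ∣ N → ¬ ((p : ℤ) ∣ A ∧ (p : ℤ) ∣ X ∧ (p : ℤ) ∣ Y) := by
  classical
  have hex : ∃ N : ℕ, 0 < N ∧ ∃ A X Y : ℤ, α = 2 * Real.pi * A / N ∧ x = 2 * Real.pi * X / N ∧
      y = 2 * Real.pi * Y / N := by
    obtain ⟨q, rfl⟩ := hα
    obtain ⟨r, rfl⟩ := hx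
    obtain ⟨s, rfl⟩ := hy
    have hq : (q.den : ℝ) ≠ 0 := by exact_mod_cast q.den_ne_zero
    have hr : (r.den : ℝ) ≠ 0 := by exact_mod_cast r.den_ne_zero
    have hs : (s.den : ℝ) ≠ 0 := by exact_mod_cast s.den_ne_zero
    refine ⟨2 * (q.den * r.den * s.den), by have := q.pos; have := r.pos; have := s.pos; positivity,
      q.num * r.den * s.den, r.num * q.den * s.den, s.num * q.den * r.den, ?_, ?_, ?_⟩
    · rw [Rat.cast_def]; push_cast; field_simp
    · rw [Rat.cast_def]; push_cast; field_simp
    · rw [Rat.cast_def]; push_cast; field_simp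
  obtain ⟨hN, A, X, Y, hA, hX, hY⟩ := Nat.find_spec hex
  refine ⟨Nat.find hex, A, X, Y, hN, hA, hX, hY, ?_⟩
  -- A prime common to `N` and all three numerators could be cancelled, contradicting the minimality
  -- of `N`.
  rintro p hp ⟨M, hM⟩ ⟨⟨A', rfl⟩, ⟨X', rfl⟩, ⟨Y', rfl⟩⟩
  have hM0 : 0 < M := Nat.pos_of_ne_zero (by rintro rfl; omega)
  have hlt : M < Nat.find hex := by
    rw [hM]
    exact lt_mul_of_one_lt_left hM0 hp.one_lt
  have hp0 : (p : ℝ) ≠ 0 := by exact_mod_cast hp.ne_zero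
  have hM0' : (M : ℝ) ≠ 0 := by exact_mod_cast hM0.ne'
  have hred : ∀ B : ℤ, 2 * Real.pi * ((p * B : ℤ) : ℝ) / (Nat.find hex : ℕ)
      = 2 * Real.pi * B / M := by
    intro B
    rw [hM]
    push_cast
    field_simp
  rw [hred] at hA hX hY
  exact Nat.find_min hex hlt ⟨hM0, A', X', Y', hA, hX, hY⟩

/-- The rational solutions of `cos (α + x) + cos (α - x) = cos x + cos y` in the given range. -/
theorem rational_angle_classification {α x y : ℝ} (hαq : IsRationalAngle α)
    (hxq : IsRationalAngle x) (hyq : IsRationalAngle y)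
    (hα : Real.pi / 3 < α) (hα' : α < Real.pi / 2)
    (hx : 0 ≤ x) (hx' : x < Real.pi / 2) (hy : Real.pi / 2 < y) (hy' : y < Real.pi)
    (h : Real.cos (α + x) + Real.cos (α - x) - Real.cos x - Real.cos y = 0) :
    (α = 4 / 9 * Real.pi ∧ x = 1 / 18 * Real.pi ∧ y = 13 / 18 * Real.pi) ∨
      (α = 3 / 7 * Real.pi ∧ x = 1 / 7 * Real.pi ∧ y = 2 / 3 * Real.pi) ∨
      (α = 2 * x ∧ y = 3 * x) := by
  have hpi := Real.pi_pos
  obtain ⟨N, A, X, Y, hN, hA, hX, hY, hmin⟩ := exists_reduced_common_denominator hαq hxq hyq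
  have hN0 : (N : ℝ) ≠ 0 := by exact_mod_cast hN.ne'
  have hplus : 2 * Real.pi * ((A + X : ℤ) : ℝ) / N = α + x := by
    rw [hA, hX]; push_cast; ring
  have hminus : 2 * Real.pi * ((A - X : ℤ) : ℝ) / N = α - x := by
    rw [hA, hX]; push_cast; ring
  by_cases hdvd : N ∣ 420
  · obtain ⟨k, hk⟩ := hdvd
    have hkR : (420 : ℝ) = N * k := by exact_mod_cast hk
    have hk0 : (k : ℝ) ≠ 0 := by
      intro h0
      rw [h0, mul_zero] at hkR
      norm_num at hkR
    have hscale : ∀ B : ℤ, 2 * Real.pi * ((k * B : ℤ) : ℝ) / 420 = 2 * Real.pi * B / N := by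
      intro B
      rw [hkR]; push_cast; field_simp
    rw [← hscale] at hA hX hY
    have hres : (k * A = 2 * (k * X) ∨ (k * A = 90 ∧ k * X = 30)) := by
      refine four_cos_of_denominator_420 (Y := k * Y) ?_ ?_ ?_ ?_ ?_
      · have : (70 : ℝ) < ((k * A : ℤ) : ℝ) := by
          rw [hA] at hα
          nlinarith
        exact_mod_cast this
      · have : ((k * A : ℤ) : ℝ) < (105 : ℝ) := by
          rw [hA] at hα'
          nlinarith
        exact_mod_cast this
      · have : (0 : ℝ) ≤ ((k * X : ℤ) : ℝ) := by
          rw [hX] at hx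
          by_contra! h0
          nlinarith
        exact_mod_cast this
      · have : ((k * X : ℤ) : ℝ) < (105 : ℝ) := by
          rw [hX] at hx'
          nlinarith
        exact_mod_cast this
      · rw [Fin.sum_univ_four]
        have hp : 2 * Real.pi * ((k * A + k * X : ℤ) : ℝ) / 420 = α + x := by
          rw [hA, hX]; push_cast; ring
        have hm : 2 * Real.pi * ((k * A - k * X : ℤ) : ℝ) / 420 = α - x := by
          rw [hA, hX]; push_cast; ring
        simp only [Matrix.cons_val, Nat.cast_ofNat, hp, hm, ← hX, ← hY]
        push_cast
        linarith
    rcases hres with hr | ⟨hr1, hr2⟩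
    · right; right
      have h1 : α = 2 * x := by rw [hA, hX, hr]; push_cast; ring
      refine ⟨h1, ?_⟩
      refine Real.injOn_cos ⟨by linarith, by linarith⟩ ⟨by linarith, by linarith⟩ ?_
      rw [h1, show 2 * x + x = 3 * x by ring, show 2 * x - x = x by ring] at h
      linarith
    · right; left
      have h1 : α = 3 / 7 * Real.pi := by rw [hA, hr1]; push_cast; ring
      have h2 : x = 1 / 7 * Real.pi := by rw [hX, hr2]; push_cast; ring
      refine ⟨h1, h2, ?_⟩
      refine Real.injOn_cos ⟨by linarith, by linarith⟩ ⟨by linarith, by linarith⟩ ?_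
      rw [h1, h2, show 3 / 7 * Real.pi + 1 / 7 * Real.pi = 4 / 7 * Real.pi by ring,
        show 3 / 7 * Real.pi - 1 / 7 * Real.pi = 2 / 7 * Real.pi by ring] at h
      rw [show 2 / 3 * Real.pi = Real.pi - Real.pi / 3 by ring, Real.cos_pi_sub,
        Real.cos_pi_div_three]
      linarith [cos_heptagon]
  · obtain ⟨δ, h1, ⟨k, hk⟩, h2, h3⟩ := exists_signs_of_not_dvd hN hdvd ![1, 1, -1, -1]
      ![A + X, A - X, X, Y] (by
        intro p hp hpN
        by_contra! hall
        have g0 : (p : ℤ) ∣ A + X := hall 0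
        have g2 : (p : ℤ) ∣ X := hall 2
        have g3 : (p : ℤ) ∣ Y := hall 3
        exact hmin p hp hpN ⟨(dvd_add_left g2).1 g0, g2, g3⟩) (by
        rw [Fin.sum_univ_four]
        simp only [Matrix.cons_val, hplus, hminus, ← hX, ← hY]
        push_cast
        linarith)
    rw [Fin.sum_univ_four] at h2 h3
    simp only [Matrix.cons_val, hplus, hminus, ← hX, ← hY] at h2 h3
    push_cast at h2 h3
    have hδ : ∀ i, (δ i : ℝ) = 0 ∨ (δ i : ℝ) ^ 2 = 1 := by
      intro i
      rcases h1 i with h4 | h4 | h4 <;> simp [h4]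
    rcases angles_of_signed_subsum hα hα' hx hx' hy hy' h (hδ 0) (hδ 1) (hδ 2) (hδ 3) (by
        rintro ⟨i0, i1, i2, i3⟩
        apply hk
        fin_cases k
        · exact_mod_cast i0
        · exact_mod_cast i1
        · exact_mod_cast i2
        · exact_mod_cast i3) (by linarith) (by linarith) with h4 | h4
    · exact Or.inl h4
    · exact Or.inr (Or.inr h4)

/-! ### Trigonometry of the triangle and the rhombus -/

/-- Multiplicativity of the determinant, applied to one matrix and the transpose of the other. It
expresses products of orientations through cosines of distances. -/
theorem orient_mul_orient (A B C D E F : S2) :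
    orient A B C * orient D E F = Matrix.det
      !![inner ℝ (A : E3) D, inner ℝ (A : E3) E, inner ℝ (A : E3) F;
         inner ℝ (B : E3) D, inner ℝ (B : E3) E, inner ℝ (B : E3) F;
         inner ℝ (C : E3) D, inner ℝ (C : E3) E, inner ℝ (C : E3) F] := by
  simp only [orient, Matrix.det_fin_three, PiLp.inner_apply, Fin.sum_univ_three, Matrix.of_apply,
    Matrix.cons_val', Matrix.cons_val, RCLike.inner_apply, conj_trivial]
  ring

theorem inner_self_S2 (u : S2) : inner ℝ (u : E3) (u : E3) = (1 : ℝ) := by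
  rw [real_inner_self_eq_norm_sq, norm_eq_of_mem_sphere, one_pow]

theorem cos_sDist (u v : S2) : Real.cos (sDist u v) = inner ℝ (u : E3) (v : E3) := by
  rw [sDist, InnerProductGeometry.cos_angle, norm_eq_of_mem_sphere, norm_eq_of_mem_sphere, mul_one,
    div_one]

theorem sDist_comm (u v : S2) : sDist u v = sDist v u := InnerProductGeometry.angle_comm _ _

theorem inner_tangentDir (v u w : S2) :
    inner ℝ (tangentDir v u) (tangentDir v w)
      = inner ℝ (u : E3) (w : E3) - inner ℝ (v : E3) (u : E3) * inner ℝ (v : E3) (w : E3) := by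
  simp only [tangentDir, inner_sub_left, inner_sub_right, real_inner_smul_left,
    real_inner_smul_right, inner_self_S2]
  rw [real_inner_comm (v : E3) (u : E3)]
  ring

/-- The spherical law of cosines for two sides of equal length. -/
theorem cos_arcAngle_mul {u v w : S2} {a : ℝ} (h₁ : sDist u v = a) (h₂ : sDist v w = a) :
    Real.cos (arcAngle u v w) * (1 - Real.cos a ^ 2)
      = inner ℝ (u : E3) (w : E3) - Real.cos a ^ 2 := by
  have e₁ : inner ℝ (v : E3) (u : E3) = Real.cos a := by rw [← cos_sDist, sDist_comm, h₁]
  have e₂ : inner ℝ (v : E3) (w : E3) = Real.cos a := by rw [← cos_sDist, h₂]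
  have n₁ : ‖tangentDir v u‖ ^ 2 = 1 - Real.cos a ^ 2 := by
    rw [← real_inner_self_eq_norm_sq, inner_tangentDir, inner_self_S2, e₁]; ring
  have n₂ : ‖tangentDir v w‖ ^ 2 = 1 - Real.cos a ^ 2 := by
    rw [← real_inner_self_eq_norm_sq, inner_tangentDir, inner_self_S2, e₂]; ring
  have n : ‖tangentDir v u‖ = ‖tangentDir v w‖ := by
    rw [← sq_eq_sq₀ (norm_nonneg _) (norm_nonneg _), n₁, n₂]
  have := InnerProductGeometry.cos_angle_mul_norm_mul_norm (tangentDir v u) (tangentDir v w)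
  rw [inner_tangentDir, e₁, e₂, ← n, ← sq, n₁, ← sq] at this
  exact this

theorem arcAngle_of_interiorAngle_lt_pi {u v w : S2} {θ : ℝ} (h : interiorAngle u v w = θ)
    (hθ : θ < Real.pi) : 0 ≤ orient u v w ∧ arcAngle u v w = θ := by
  unfold interiorAngle at h
  split_ifs at h with h0
  · exact ⟨h0, h⟩
  · have : arcAngle u v w ≤ Real.pi := InnerProductGeometry.angle_le_pi _ _
    linarith

theorem inner_lt_one {u v : S2} (h : u ≠ v) : inner ℝ (u : E3) (v : E3) < 1 := by
  have h1 : (inner ℝ (u : E3) (v : E3) : ℝ) ≤ 1 := by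
    have := real_inner_le_norm (u : E3) (v : E3)
    rwa [norm_eq_of_mem_sphere, norm_eq_of_mem_sphere, mul_one] at this
  refine lt_of_le_of_ne h1 fun h2 => h ?_
  exact Subtype.ext ((inner_eq_one_iff_of_norm_eq_one (norm_eq_of_mem_sphere u)
    (norm_eq_of_mem_sphere v)).1 h2)

theorem ne_of_arc_inter {u v w : S2} (h : arc u v ∩ arc v w = {v}) (huv : u ≠ v) : u ≠ w := by
  rintro rfl
  have h0 : sDist u u = 0 := by
    rw [sDist, InnerProductGeometry.angle_self (ne_zero_of_mem_unit_sphere u)]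
  have : u ∈ arc u v ∩ arc v u := by
    refine ⟨?_, ?_⟩
    · change sDist u u + sDist u v = sDist u v
      rw [h0, zero_add]
    · change sDist v u + sDist u u = sDist v u
      rw [h0, add_zero]
  rw [h] at this
  exact huv this

theorem IsRegularTriangle.cos_angle {a α : ℝ} {A B C : S2} (h : IsRegularTriangle a α A B C)
    (ha : Real.cos a ≠ 1) :
    0 ≤ α ∧ α ≤ Real.pi ∧ Real.cos α * (1 + Real.cos a) = Real.cos a := by
  have ho : 0 ≤ orient C A B := by
    have : orient C A B = orient A B C := by
      simp only [orient, Matrix.det_fin_three, Matrix.of_apply, Matrix.cons_val', Matrix.cons_val]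
      ring
    rw [this]
    exact h.pos.le
  have hα : arcAngle C A B = α := by
    have := h.angle_A
    rwa [interiorAngle, if_pos ho] at this
  refine ⟨hα ▸ InnerProductGeometry.angle_nonneg _ _, hα ▸ InnerProductGeometry.angle_le_pi _ _, ?_⟩
  have h1 := cos_arcAngle_mul h.side_CA h.side_AB
  rw [hα, real_inner_comm, ← cos_sDist, h.side_BC] at h1
  have h2 : (1 - Real.cos a) * (Real.cos α * (1 + Real.cos a) - Real.cos a) = 0 := by
    linear_combination h1
  have h3 := (mul_eq_zero.1 h2).resolve_left (sub_ne_zero.2 ha.symm)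
  linarith

/-- The angles of a convex spherical rhombus satisfy `cos a = cot (β / 2) * cot (γ / 2)`. -/
theorem IsRhombus.cos_side {a β γ : ℝ} {P Q R S : S2} (h : IsRhombus a β γ P Q R S)
    (hβ : β < Real.pi) (hγ : γ < Real.pi) :
    0 ≤ β ∧ 0 ≤ γ ∧ Real.cos a ≠ 1 ∧ 0 ≤ Real.cos a ∧
      Real.cos a * (Real.sin (β / 2) * Real.sin (γ / 2))
        = Real.cos (β / 2) * Real.cos (γ / 2) := by
  have hpi := Real.pi_pos
  obtain ⟨oP, aP⟩ := arcAngle_of_interiorAngle_lt_pi h.angle_P hβ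
  obtain ⟨oQ, aQ⟩ := arcAngle_of_interiorAngle_lt_pi h.angle_Q hγ
  have hPQ : P ≠ Q := by
    rintro rfl
    have h1 := h.side_PQ
    rw [sDist, InnerProductGeometry.angle_self (ne_zero_of_mem_unit_sphere P)] at h1
    exact h.side_pos.ne h1
  have hQR : Q ≠ R := by
    rintro rfl
    have h1 := h.side_QR
    rw [sDist, InnerProductGeometry.angle_self (ne_zero_of_mem_unit_sphere Q)] at h1
    exact h.side_pos.ne h1
  have hPR : P ≠ R := ne_of_arc_inter h.simple.meet_Q hPQ
  have hQS : Q ≠ S := ne_of_arc_inter h.simple.meet_R hQR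
  have cP := cos_arcAngle_mul h.side_SP h.side_PQ
  have cQ := cos_arcAngle_mul h.side_PQ h.side_QR
  rw [aP] at cP
  rw [aQ] at cQ
  have hp := inner_lt_one hPR
  have hq := inner_lt_one hQS
  rw [real_inner_comm] at cP
  have ePQ : inner ℝ (P : E3) (Q : E3) = Real.cos a := by rw [← cos_sDist, h.side_PQ]
  have eQR : inner ℝ (Q : E3) (R : E3) = Real.cos a := by rw [← cos_sDist, h.side_QR]
  have eSP : inner ℝ (S : E3) (P : E3) = Real.cos a := by rw [← cos_sDist, h.side_SP]
  have eQP : inner ℝ (Q : E3) (P : E3) = Real.cos a := by rw [real_inner_comm, ePQ]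
  have eRQ : inner ℝ (R : E3) (Q : E3) = Real.cos a := by rw [real_inner_comm, eQR]
  have eSR : inner ℝ (S : E3) (R : E3) = Real.cos a := by rw [← cos_sDist, sDist_comm, h.side_RS]
  have ePS : inner ℝ (P : E3) (S : E3) = Real.cos a := by rw [real_inner_comm, eSP]
  have eRP : inner ℝ (R : E3) (P : E3) = inner ℝ (P : E3) (R : E3) := real_inner_comm _ _
  have eSQ : inner ℝ (S : E3) (Q : E3) = inner ℝ (Q : E3) (S : E3) := real_inner_comm _ _
  have m₁ := orient_mul_orient S P Q P Q R
  have m₂ := orient_mul_orient S P Q S P Q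
  have m₃ := orient_mul_orient P Q R P Q R
  simp only [Matrix.det_fin_three, Matrix.of_apply, Matrix.cons_val', Matrix.cons_val,
    inner_self_S2, ePQ, eQR, eSP, eQP, eRQ, eSR, ePS, eRP, eSQ] at m₁ m₂ m₃
  have hca : Real.cos a ≠ 1 := by
    intro h1
    have := inner_lt_one hPQ
    linarith
  set c := Real.cos a with hc
  set p : ℝ := inner ℝ (P : E3) (R : E3) with hpdef
  set q : ℝ := inner ℝ (Q : E3) (S : E3) with hqdef
  -- Convexity makes both orientations nonnegative, so this product fixes the sign of `c`.
  have m₁' : orient S P Q * orient P Q R = c * ((1 - p) * (1 - q)) := by rw [m₁]; ring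
  have hpq : 0 < (1 - p) * (1 - q) := mul_pos (by linarith) (by linarith)
  have hc0 : 0 ≤ c := by
    by_contra! h1
    have h2 := mul_nonneg oP oQ
    rw [m₁'] at h2
    nlinarith
  have hc1 : c < 1 := lt_of_le_of_ne (Real.cos_le_one a) hca
  -- Squaring `m₁'` and replacing each squared orientation by its Gram determinant leaves a common
  -- factor `(1 - p) * (1 - q)`, which cancels.
  have hsq : (1 + q - 2 * c ^ 2) * (1 + p - 2 * c ^ 2) = c ^ 2 * ((1 - p) * (1 - q)) := by
    have h1 : ((1 - p) * (1 - q)) * ((1 + q - 2 * c ^ 2) * (1 + p - 2 * c ^ 2)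
        - c ^ 2 * ((1 - p) * (1 - q))) = 0 := by
      linear_combination (orient S P Q * orient P Q R + c * ((1 - p) * (1 - q))) * m₁'
        - (orient P Q R * orient P Q R) * m₂ - (2 * c * c * q + 1 - q ^ 2 - 2 * c ^ 2) * m₃
    have := (mul_eq_zero.1 h1).resolve_left hpq.ne'
    linarith
  have hc2 : 0 < 1 - c ^ 2 := by nlinarith
  have hβ0 : 0 ≤ β := aP ▸ InnerProductGeometry.angle_nonneg _ _
  have hγ0 : 0 ≤ γ := aQ ▸ InnerProductGeometry.angle_nonneg _ _
  refine ⟨hβ0, hγ0, hca, hc0, ?_⟩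
  have dβ : Real.cos β = 2 * Real.cos (β / 2) ^ 2 - 1 := by rw [← Real.cos_two_mul]; congr 1; ring
  have dγ : Real.cos γ = 2 * Real.cos (γ / 2) ^ 2 - 1 := by rw [← Real.cos_two_mul]; congr 1; ring
  have sβ : 0 ≤ Real.sin (β / 2) := Real.sin_nonneg_of_nonneg_of_le_pi (by linarith) (by linarith)
  have sγ : 0 ≤ Real.sin (γ / 2) := Real.sin_nonneg_of_nonneg_of_le_pi (by linarith) (by linarith)
  have kβ : 0 ≤ Real.cos (β / 2) := Real.cos_nonneg_of_mem_Icc ⟨by linarith, by linarith⟩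
  have kγ : 0 ≤ Real.cos (γ / 2) := Real.cos_nonneg_of_mem_Icc ⟨by linarith, by linarith⟩
  -- Both sides are nonnegative, so it suffices to compare squares; the law of cosines turns `hsq`
  -- into that comparison.
  rw [← sq_eq_sq₀ (by positivity) (by positivity), mul_pow, mul_pow, mul_pow, Real.sin_sq,
    Real.sin_sq]
  have q1 : 1 - q = (1 - c ^ 2) * (2 * (1 - Real.cos (β / 2) ^ 2)) := by
    rw [dβ] at cP; linear_combination cP
  have q2 : 1 + q - 2 * c ^ 2 = (1 - c ^ 2) * (2 * Real.cos (β / 2) ^ 2) := by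
    rw [dβ] at cP; linear_combination -cP
  have p1 : 1 - p = (1 - c ^ 2) * (2 * (1 - Real.cos (γ / 2) ^ 2)) := by
    rw [dγ] at cQ; linear_combination cQ
  have p2 : 1 + p - 2 * c ^ 2 = (1 - c ^ 2) * (2 * Real.cos (γ / 2) ^ 2) := by
    rw [dγ] at cQ; linear_combination -cQ
  rw [q1, q2, p1, p2] at hsq
  refine mul_left_cancel₀ (pow_ne_zero 2 hc2.ne') ?_
  linear_combination (-1 / 4) * hsq

theorem IsRationalAngle.half_add {β γ : ℝ} (hβ : IsRationalAngle β) (hγ : IsRationalAngle γ) :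
    IsRationalAngle ((β + γ) / 2) := by
  obtain ⟨q, rfl⟩ := hβ
  obtain ⟨r, rfl⟩ := hγ
  exact ⟨(q + r) / 2, by push_cast; ring⟩

theorem IsRationalAngle.half_sub {β γ : ℝ} (hβ : IsRationalAngle β) (hγ : IsRationalAngle γ) :
    IsRationalAngle ((β - γ) / 2) := by
  obtain ⟨q, rfl⟩ := hβ
  obtain ⟨r, rfl⟩ := hγ
  exact ⟨(q - r) / 2, by push_cast; ring⟩

end SphericalTiling

/-! ### From the geometry to the list of angles -/

theorem mainTheorem3 (a α β γ : ℝ)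
    (hproto : SphericalTiling.IsProtoset a α β γ)
    (hconvex : SphericalTiling.IsConvexAngle β)
    (hrational : SphericalTiling.IsRationalAngle α ∧ SphericalTiling.IsRationalAngle β ∧
      SphericalTiling.IsRationalAngle γ) :
    (α = 4 / 9 * Real.pi ∧ β = 7 / 9 * Real.pi ∧ γ = 2 / 3 * Real.pi) ∨
    (α = 3 / 7 * Real.pi ∧ β = 17 / 21 * Real.pi ∧ γ = 11 / 21 * Real.pi) ∨
    (∃ q : ℚ, 1 / 3 < q ∧ q < 1 / 2 ∧
      α = (q : ℝ) * Real.pi ∧ β = 2 * α ∧ γ = α) := by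
  have hpi := Real.pi_pos
  obtain ⟨⟨A, B, C, hT⟩, ⟨P, Q, R, S, hR⟩, hle⟩ := hproto
  have hβ : β < Real.pi := hconvex
  obtain ⟨hαq, hβq, hγq⟩ := hrational
  obtain ⟨hβ0, hγ0, hc1, hc0, hrh⟩ := hR.cos_side hβ (hle.trans_lt hβ)
  obtain ⟨hα0, hαpi, htr⟩ := hT.cos_angle hc1
  have kβ : 0 < Real.cos (β / 2) := Real.cos_pos_of_mem_Ioo ⟨by linarith, by linarith⟩
  have kγ : 0 < Real.cos (γ / 2) := Real.cos_pos_of_mem_Ioo ⟨by linarith, by linarith⟩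
  have hcpos : 0 < Real.cos a := by
    refine lt_of_le_of_ne hc0 fun h0 => ?_
    rw [← h0, zero_mul] at hrh
    exact (mul_pos kβ kγ).ne hrh
  have hclt : Real.cos a < 1 := lt_of_le_of_ne (Real.cos_le_one a) hc1
  have hγpos : 0 < γ := by
    refine lt_of_le_of_ne hγ0 fun h0 => ?_
    rw [← h0, zero_div, Real.sin_zero, mul_zero, mul_zero] at hrh
    rw [← h0, zero_div] at kγ
    exact (mul_pos kβ kγ).ne hrh
  -- Since `cos α = c / (1 + c)` with `0 < c < 1`, it lies strictly between `0` and `1 / 2`.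
  have hcosα : 0 < Real.cos α := by
    by_contra! h0
    nlinarith
  have hcosα' : Real.cos α < 1 / 2 := by
    by_contra! h0
    nlinarith
  have hα1 : Real.pi / 3 < α := by
    by_contra! h0
    have := Real.cos_le_cos_of_nonneg_of_le_pi hα0 (by linarith) h0
    rw [Real.cos_pi_div_three] at this
    linarith
  have hα2 : α < Real.pi / 2 := by
    by_contra! h0
    have := Real.cos_nonpos_of_pi_div_two_le_of_le h0 (by linarith)
    linarith
  have hβs : 0 < Real.sin (β / 2) := Real.sin_pos_of_pos_of_lt_pi (by linarith) (by linarith)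
  have hγs : 0 < Real.sin (γ / 2) := Real.sin_pos_of_pos_of_lt_pi (by linarith) (by linarith)
  have hx : Real.cos ((β - γ) / 2) = Real.cos (β / 2) * Real.cos (γ / 2)
      + Real.sin (β / 2) * Real.sin (γ / 2) := by rw [sub_div, Real.cos_sub]
  have hy : Real.cos ((β + γ) / 2) = Real.cos (β / 2) * Real.cos (γ / 2)
      - Real.sin (β / 2) * Real.sin (γ / 2) := by rw [add_div, Real.cos_add]
  -- By the rhombus relation `cos y = (c - 1) * sin (β/2) * sin (γ/2)`.
  have hyneg : Real.cos ((β + γ) / 2) < 0 := by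
    rw [hy, ← hrh]
    nlinarith [mul_pos hβs hγs]
  have hygt : Real.pi / 2 < (β + γ) / 2 := by
    by_contra! h0
    have := Real.cos_nonneg_of_mem_Icc (x := (β + γ) / 2) ⟨by linarith, h0⟩
    linarith
  have hmain : Real.cos (α + (β - γ) / 2) + Real.cos (α - (β - γ) / 2) - Real.cos ((β - γ) / 2)
      - Real.cos ((β + γ) / 2) = 0 := by
    rw [Real.cos_add, Real.cos_sub, hx, hy]
    linear_combination 2 * (Real.sin (β / 2) * Real.sin (γ / 2)) * htr
      + 2 * (1 - Real.cos α) * hrh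
  rcases SphericalTiling.rational_angle_classification hαq (hβq.half_sub hγq) (hβq.half_add hγq)
    hα1 hα2 (by linarith) (by linarith) hygt (by linarith) hmain with
    ⟨h1, h2, h3⟩ | ⟨h1, h2, h3⟩ | ⟨h1, h2⟩
  · exact Or.inl ⟨h1, by linarith, by linarith⟩
  · exact Or.inr (Or.inl ⟨h1, by linarith, by linarith⟩)
  · obtain ⟨q, hq⟩ := hαq
    refine Or.inr (Or.inr ⟨q, ?_, ?_, hq, by linarith, by linarith⟩)
    · have : ((1 / 3 : ℚ) : ℝ) < (q : ℝ) := by rw [hq] at hα1; push_cast; nlinarith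
      exact Rat.cast_lt.1 this
    · have : (q : ℝ) < ((1 / 2 : ℚ) : ℝ) := by rw [hq] at hα2; push_cast; nlinarith
      exact Rat.cast_lt.1 this
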